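/- Identify $\mathbb{R}^3$ with the reduced quaternions $\{a_0+\mathbf{i}a_1+\mathbf{j}a_2 : a_0,a_1,a_2\in\mathbb{R}\}\subset\mathbb{H}$, and let $D=\mathbf{i}\,\frac{\partial}{\partial x}+\mathbf{j}\,\frac{\partial}{\partial y}$, acting by quaternionic multiplication from the left. Let $\Omega\subseteq\mathbb{R}^2$ be an open set (in particular, any domain) and let $\lambda\in\mathbb{R}\setminus\{0\}$. Let $\mathcal{M}(\Omega;\lambda)$ be the set of functions $F\in C^1(\Omega,\mathbb{R}^3)$ with $(D+\lambda)F=0$ in $\Omega$ (the $\lambda$-metamonogenic functions), and let $\mathcal{M}_2(\Omega;\lambda)=\mathcal{M}(\Omega;\lambda)\cap L^2(\Omega,\mathbb{R}^3)$. (i) If $F_n\in\mathcal{M}(\Omega;\lambda)$ for all $n$ and $F_n\to F$ uniformly on every compact subset of $\Omega$, then $F\in\mathcal{M}(\Omega;\lambda)$. (ii) If $F_n\in\mathcal{M}_2(\Omega;\lambda)$ for all $n$, $F\in\mathcal{M}_2(\Omega;\lambda)$, and $\|F_n-F\|_{L^2(\Omega)}\to0$, then $F_n\to F$ uniformly on every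 compact subset of $\Omega$. -/

import Mathlib

open Filter Topology MeasureTheory
open scoped Quaternion

noncomputable section

namespace Metamonogenic

/-- The quaternionic imaginary unit `i`. -/
def unitI : ℍ[ℝ] := ⟨0, 1, 0, 0⟩

/-- The quaternionic imaginary unit `j`. -/
def unitJ : ℍ[ℝ] := ⟨0, 0, 1, 0⟩

/-- The operator `D = i ∂/∂x + j ∂/∂y`, acting from the left on quaternion-valued functions
of `(x, y)` that are differentiable at the point. -/
def opD (F : ℝ × ℝ → ℍ[ℝ]) (z : ℝ × ℝ) : ℍ[ℝ] :=
  unitI * fderiv ℝ F z (1, 0) + unitJ * fderiv ℝ F z (0, 1)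

/-- The functions that are `lam`-metamonogenic on `Ω`: those of class `C¹` on `Ω`, with values in
the reduced quaternions (the copy of `ℝ³` spanned by `1, i, j`), in the kernel of `D + lam`.
Only the values on `Ω` matter when `Ω` is open. -/
def M (Ω : Set (ℝ × ℝ)) (lam : ℝ) : Set (ℝ × ℝ → ℍ[ℝ]) :=
  {F | ContDiffOn ℝ 1 F Ω ∧ (∀ z ∈ Ω, (F z).imK = 0) ∧ ∀ z ∈ Ω, opD F z + lam • F z = 0}

/-- The square-integrable `lam`-metamonogenic functions on `Ω`. -/
def M₂ (Ω : Set (ℝ × ℝ)) (lam : ℝ) : Set (ℝ × ℝ → ℍ[ℝ]) :=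
  M Ω lam ∩ {F | MemLp F 2 (volume.restrict Ω)}

end Metamonogenic

end

namespace Metamonogenic

open Set Real

/-! Write `F = u + i v + j w`. The `i`- and `j`-components of `(D + lam) F = 0` say `∇u = -lam (v,
w)`, and the real part says `div (v, w) = lam u`. This is the Helmholtz equation for `u` in
first-order form, so `C¹` regularity suffices.

Solutions have a mean value property: the average of `u` against a small radial bump `φ` about `z`
is `c * u z`, with `c > 0` independent of `u` and `z` (`HelmholtzSystem.integral_radial_mul`). Hence
`u = c⁻¹ (u ⋆ φ)` locally. Since `lam ≠ 0`, `(v, w) = -lam⁻¹ ∇u` is a convolution of `u` with `∇φ`.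
So `F` is locally the convolution of its own first component with one fixed compactly supported `C¹`
kernel (`exists_reproducing_kernel`).

Both claims follow. Under locally uniform convergence the convolutions and their derivatives
converge, so the limit is `C¹` and satisfies the equation. The kernel also bounds values by a local
`L¹` norm, hence by the `L²` norm, which gives the second claim by linearity. -/

/-- Differentiation under an interval integral, for an integrand that is continuous together with
its derivative in the parameter. -/
theorem hasDerivAt_intervalIntegral_of_continuousOn {F F' : ℝ → ℝ → ℝ} {U : Set ℝ}
    (hU : IsOpen U) (a b : ℝ)
    (hF : ContinuousOn (Function.uncurry F) (U ×ˢ univ))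
    (hF' : ContinuousOn (Function.uncurry F') (U ×ˢ univ))
    (hd : ∀ r ∈ U, ∀ t, HasDerivAt (fun s => F s t) (F' r t) r) {r : ℝ} (hr : r ∈ U) :
    HasDerivAt (fun s => ∫ t in a..b, F s t) (∫ t in a..b, F' r t) r := by
  have slice : ∀ {G : ℝ → ℝ → ℝ}, ContinuousOn (Function.uncurry G) (U ×ˢ univ) →
      ∀ s ∈ U, Continuous (G s) := by
    intro G hG s hs
    rw [← continuousOn_univ]
    exact hG.comp (f := fun t => (s, t)) (by fun_prop) (fun t _ => ⟨hs, mem_univ _⟩)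
  obtain ⟨ε, hε, hball⟩ := Metric.nhds_basis_closedBall.mem_iff.1 (hU.mem_nhds hr)
  obtain ⟨C, hC⟩ := ((isCompact_closedBall r ε).prod (isCompact_uIcc (a := a) (b := b))
    ).exists_bound_of_continuousOn
    (hF'.mono (prod_mono hball (subset_univ _)))
  refine (intervalIntegral.hasDerivAt_integral_of_dominated_loc_of_deriv_le
    (bound := fun _ => C) (Metric.closedBall_mem_nhds r hε) ?_ ?_ ?_ ?_ ?_ ?_).2
  · filter_upwards [hU.mem_nhds hr] with s hs
    exact (slice hF s hs).aestronglyMeasurable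
  · exact (slice hF r hr).intervalIntegrable _ _
  · exact (slice hF' r hr).aestronglyMeasurable
  · exact Eventually.of_forall fun t ht s hs => hC (s, t) ⟨hs, uIoc_subset_uIcc ht⟩
  · exact intervalIntegrable_const
  · exact Eventually.of_forall fun t _ s hs => hd s (hball hs) t

/-! ### Circular means for the first-order Helmholtz system. -/

/-- The first-order system satisfied by the components of a metamonogenic function: the first
component solves the Helmholtz equation, the others are multiples of its partial derivatives. -/
structure HelmholtzSystem (Ω : Set (ℝ × ℝ)) (lam : ℝ) (u v w : ℝ × ℝ → ℝ) : Prop where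
  contDiffOn_u : ContDiffOn ℝ 1 u Ω
  contDiffOn_v : ContDiffOn ℝ 1 v Ω
  contDiffOn_w : ContDiffOn ℝ 1 w Ω
  fderiv_u : ∀ z ∈ Ω, ∀ h, fderiv ℝ u z h = -lam * (v z * h.1 + w z * h.2)
  div : ∀ z ∈ Ω, fderiv ℝ v z (1, 0) + fderiv ℝ w z (0, 1) = lam * u z

/-- The point at polar coordinates `(r, t)` about `z`. -/
noncomputable def circlePoint (z : ℝ × ℝ) (r t : ℝ) : ℝ × ℝ := (z.1 + r * cos t, z.2 + r * sin t)

/-- Balls of `ℝ × ℝ` are squares for the sup norm, and the Euclidean circle of radius `|r|` fits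
inside. -/
theorem circlePoint_mem_ball {z : ℝ × ℝ} {ρ r : ℝ} (hr : |r| < ρ) (t : ℝ) :
    circlePoint z r t ∈ Metric.ball z ρ := by
  rw [Metric.mem_ball, Prod.dist_eq, max_lt_iff]
  have h1 : |r * cos t| ≤ |r| := by
    rw [abs_mul]; exact mul_le_of_le_one_right (abs_nonneg r) (abs_cos_le_one t)
  have h2 : |r * sin t| ≤ |r| := by
    rw [abs_mul]; exact mul_le_of_le_one_right (abs_nonneg r) (abs_sin_le_one t)
  simp only [circlePoint, Real.dist_eq, add_sub_cancel_left]
  exact ⟨h1.trans_lt hr, h2.trans_lt hr⟩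

theorem continuous_circlePoint (z : ℝ × ℝ) :
    Continuous (fun p : ℝ × ℝ => circlePoint z p.1 p.2) := by
  unfold circlePoint; fun_prop

theorem hasDerivAt_circlePoint_left (z : ℝ × ℝ) (r t : ℝ) :
    HasDerivAt (fun s => circlePoint z s t) (cos t, sin t) r := by
  have h1 := ((hasDerivAt_id r).mul_const (cos t)).const_add z.1
  have h2 := ((hasDerivAt_id r).mul_const (sin t)).const_add z.2
  simpa [circlePoint] using h1.prodMk h2

theorem hasDerivAt_circlePoint_right (z : ℝ × ℝ) (r t : ℝ) :
    HasDerivAt (fun s => circlePoint z r s) (-(r * sin t), r * cos t) t := by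
  have h1 := ((hasDerivAt_cos t).const_mul r).const_add z.1
  have h2 := ((hasDerivAt_sin t).const_mul r).const_add z.2
  simpa [circlePoint] using h1.prodMk h2

theorem fderiv_apply_prod (f : ℝ × ℝ → ℝ) (z : ℝ × ℝ) (a b : ℝ) :
    fderiv ℝ f z (a, b) = a * fderiv ℝ f z (1, 0) + b * fderiv ℝ f z (0, 1) := by
  have : ((a, b) : ℝ × ℝ) = a • ((1, 0) : ℝ × ℝ) + b • ((0, 1) : ℝ × ℝ) := by simp
  rw [this, map_add, map_smul, map_smul, smul_eq_mul, smul_eq_mul]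

namespace HelmholtzSystem

variable {lam : ℝ} {u v w : ℝ × ℝ → ℝ} {z : ℝ × ℝ} {ρ : ℝ}

theorem mono {Ω Ω' : Set (ℝ × ℝ)} (h : HelmholtzSystem Ω lam u v w) (hs : Ω' ⊆ Ω) :
    HelmholtzSystem Ω' lam u v w :=
  ⟨h.1.mono hs, h.2.mono hs, h.3.mono hs, fun z hz => h.4 z (hs hz), fun z hz => h.5 z (hs hz)⟩

/-- The derivative of the circular integrals of the first component. -/
theorem hasDerivAt_mean (h : HelmholtzSystem (Metric.ball z ρ) lam u v w) {r : ℝ} (hr : |r| < ρ) :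
    HasDerivAt (fun s => ∫ t in (-π)..π, u (circlePoint z s t))
      (-lam * ∫ t in (-π)..π, (v (circlePoint z r t) * cos t + w (circlePoint z r t) * sin t)) r
      := by
  rw [← intervalIntegral.integral_const_mul]
  -- Negative radii are allowed so that `r = 0` is an interior point and the derivative there is
  -- two-sided.
  have hmaps : MapsTo (fun p : ℝ × ℝ => circlePoint z p.1 p.2) (Ioo (-ρ) ρ ×ˢ univ)
      (Metric.ball z ρ) := fun p hp => circlePoint_mem_ball (abs_lt.2 hp.1) _
  have hu := h.contDiffOn_u.continuousOn.comp (continuous_circlePoint z).continuousOn hmaps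
  have hv := h.contDiffOn_v.continuousOn.comp (continuous_circlePoint z).continuousOn hmaps
  have hw := h.contDiffOn_w.continuousOn.comp (continuous_circlePoint z).continuousOn hmaps
  refine hasDerivAt_intervalIntegral_of_continuousOn (U := Ioo (-ρ) ρ) isOpen_Ioo (-π) π
    (F := fun s t => u (circlePoint z s t))
    (F' := fun s t => -lam * (v (circlePoint z s t) * cos t + w (circlePoint z s t) * sin t))
    hu ?_ ?_ (abs_lt.1 hr)
  · exact continuousOn_const.mul
      ((hv.mul (by fun_prop : Continuous fun p : ℝ × ℝ => cos p.2).continuousOn).add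
        (hw.mul (by fun_prop : Continuous fun p : ℝ × ℝ => sin p.2).continuousOn))
  · intro s hs t
    have hp := circlePoint_mem_ball (z := z) (abs_lt.2 hs) t
    have hd := ((h.contDiffOn_u.differentiableOn one_ne_zero).differentiableAt
      (Metric.isOpen_ball.mem_nhds hp)).hasFDerivAt.comp_hasDerivAt s
        (hasDerivAt_circlePoint_left z s t)
    rw [h.fderiv_u _ hp] at hd
    exact hd

/-- The derivative of the flux of `(v, w)` through circles. -/
theorem hasDerivAt_flux (h : HelmholtzSystem (Metric.ball z ρ) lam u v w) {r : ℝ} (hr : |r| < ρ) :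
    HasDerivAt (fun s => s * ∫ t in (-π)..π,
        (v (circlePoint z s t) * cos t + w (circlePoint z s t) * sin t))
      (lam * r * ∫ t in (-π)..π, u (circlePoint z r t)) r := by
  have hmaps : MapsTo (fun p : ℝ × ℝ => circlePoint z p.1 p.2) (Ioo (-ρ) ρ ×ˢ univ)
      (Metric.ball z ρ) := fun p hp => circlePoint_mem_ball (abs_lt.2 hp.1) _
  have hu := h.contDiffOn_u.continuousOn.comp (continuous_circlePoint z).continuousOn hmaps
  have hv := h.contDiffOn_v.continuousOn.comp (continuous_circlePoint z).continuousOn hmaps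
  have hw := h.contDiffOn_w.continuousOn.comp (continuous_circlePoint z).continuousOn hmaps
  have hder : ∀ {f : ℝ × ℝ → ℝ}, ContDiffOn ℝ 1 f (Metric.ball z ρ) → ∀ e,
      ContinuousOn (fun p : ℝ × ℝ => fderiv ℝ f (circlePoint z p.1 p.2) e)
        (Ioo (-ρ) ρ ×ˢ univ) := fun hf e =>
    ((hf.continuousOn_fderiv_of_isOpen Metric.isOpen_ball le_rfl).comp
      (continuous_circlePoint z).continuousOn hmaps).clm_apply continuousOn_const
  have hvd := hder h.contDiffOn_v
  have hwd := hder h.contDiffOn_w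
  have hdiff : ∀ {f : ℝ × ℝ → ℝ}, ContDiffOn ℝ 1 f (Metric.ball z ρ) → ∀ p ∈ Metric.ball z ρ,
      HasFDerivAt f (fderiv ℝ f p) p := fun hf p hp =>
    ((hf.differentiableOn one_ne_zero).differentiableAt
      (Metric.isOpen_ball.mem_nhds hp)).hasFDerivAt
  have hcos : ContinuousOn (fun p : ℝ × ℝ => cos p.2) (Ioo (-ρ) ρ ×ˢ univ) := by fun_prop
  have hsin : ContinuousOn (fun p : ℝ × ℝ => sin p.2) (Ioo (-ρ) ρ ×ˢ univ) := by fun_prop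
  have hfst : ContinuousOn (fun p : ℝ × ℝ => p.1) (Ioo (-ρ) ρ ×ˢ univ) := by fun_prop
  have main := hasDerivAt_intervalIntegral_of_continuousOn (U := Ioo (-ρ) ρ) isOpen_Ioo (-π) π
    (F := fun s t => s * (v (circlePoint z s t) * cos t + w (circlePoint z s t) * sin t))
    (F' := fun s t => (v (circlePoint z s t) * cos t + w (circlePoint z s t) * sin t) +
      s * ((cos t * fderiv ℝ v (circlePoint z s t) (1, 0) +
          sin t * fderiv ℝ v (circlePoint z s t) (0, 1)) * cos t +
        (cos t * fderiv ℝ w (circlePoint z s t) (1, 0) +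
          sin t * fderiv ℝ w (circlePoint z s t) (0, 1)) * sin t))
    (hfst.mul ((hv.mul hcos).add (hw.mul hsin)))
    (((hv.mul hcos).add (hw.mul hsin)).add (hfst.mul
      ((((hcos.mul (hvd _)).add (hsin.mul (hvd _))).mul hcos).add
        (((hcos.mul (hwd _)).add (hsin.mul (hwd _))).mul hsin))))
    (by
      intro s hs t
      have hp := circlePoint_mem_ball (z := z) (abs_lt.2 hs) t
      have h1 := (hdiff h.contDiffOn_v _ hp).comp_hasDerivAt s (hasDerivAt_circlePoint_left z s t)
      have h2 := (hdiff h.contDiffOn_w _ hp).comp_hasDerivAt s (hasDerivAt_circlePoint_left z s t)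
      rw [fderiv_apply_prod] at h1 h2
      have h3 := (hasDerivAt_id s).mul ((h1.mul_const (cos t)).add (h2.mul_const (sin t)))
      rw [id, one_mul] at h3
      exact h3)
    (abs_lt.1 hr)
  simp only [intervalIntegral.integral_const_mul] at main
  refine main.congr_deriv ?_
  have slice : ∀ {G : ℝ × ℝ → ℝ}, ContinuousOn G (Ioo (-ρ) ρ ×ˢ univ) →
      Continuous fun t => G (r, t) := by
    intro G hG
    rw [← continuousOn_univ]
    exact hG.comp (f := fun t => (r, t)) (by fun_prop) (fun t _ => ⟨abs_lt.1 hr, mem_univ _⟩)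
  -- The divergence in polar coordinates: the radial derivative of `r (v cos t + w sin t)` differs
  -- from `r div (v, w) = lam r u` by the angular derivative of `v sin t - w cos t`.
  have hθ : ∀ t, HasDerivAt
      (fun t => v (circlePoint z r t) * sin t - w (circlePoint z r t) * cos t)
      (v (circlePoint z r t) * cos t + w (circlePoint z r t) * sin t +
        r * ((cos t * fderiv ℝ v (circlePoint z r t) (1, 0) +
          sin t * fderiv ℝ v (circlePoint z r t) (0, 1)) * cos t +
        (cos t * fderiv ℝ w (circlePoint z r t) (1, 0) +
          sin t * fderiv ℝ w (circlePoint z r t) (0, 1)) * sin t) -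
        lam * r * u (circlePoint z r t)) t := by
    intro t
    have hp := circlePoint_mem_ball (z := z) hr t
    have h1 := (hdiff h.contDiffOn_v _ hp).comp_hasDerivAt t (hasDerivAt_circlePoint_right z r t)
    have h2 := (hdiff h.contDiffOn_w _ hp).comp_hasDerivAt t (hasDerivAt_circlePoint_right z r t)
    rw [fderiv_apply_prod] at h1 h2
    refine ((h1.mul (hasDerivAt_sin t)).sub (h2.mul (hasDerivAt_cos t))).congr_deriv ?_
    have h3 := h.div _ hp
    simp only [Function.comp_apply]
    linear_combination (-r) * h3 - r * (fderiv ℝ v (circlePoint z r t) (1, 0) +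
      fderiv ℝ w (circlePoint z r t) (0, 1)) * sin_sq_add_cos_sq t
  have hF'c : Continuous fun t => v (circlePoint z r t) * cos t + w (circlePoint z r t) * sin t +
        r * ((cos t * fderiv ℝ v (circlePoint z r t) (1, 0) +
          sin t * fderiv ℝ v (circlePoint z r t) (0, 1)) * cos t +
        (cos t * fderiv ℝ w (circlePoint z r t) (1, 0) +
          sin t * fderiv ℝ w (circlePoint z r t) (0, 1)) * sin t) :=
    slice (((hv.mul hcos).add (hw.mul hsin)).add (hfst.mul
      ((((hcos.mul (hvd _)).add (hsin.mul (hvd _))).mul hcos).add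
        (((hcos.mul (hwd _)).add (hsin.mul (hwd _))).mul hsin))))
  have huc : Continuous fun t => lam * r * u (circlePoint z r t) :=
    continuous_const.mul (slice hu)
  -- The angular derivative integrates to zero over a full turn, because `t = -π` and `t = π` give
  -- the same point.
  have hzero := intervalIntegral.integral_eq_sub_of_hasDerivAt (fun t _ => hθ t)
    ((hF'c.sub huc).intervalIntegrable (-π) π)
  rw [intervalIntegral.integral_sub (hF'c.intervalIntegrable _ _) (huc.intervalIntegrable _ _),
    intervalIntegral.integral_const_mul] at hzero
  simp only [circlePoint, sin_neg, cos_neg, sin_pi, cos_pi] at hzero ⊢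
  simp only [neg_zero, sub_self] at hzero
  exact sub_eq_zero.1 hzero

/-- The circular integrals of the first component vanish if it vanishes at the centre. -/
theorem mean_eq_zero (h : HelmholtzSystem (Metric.ball z ρ) lam u v w) (hρ : |lam| * ρ ≤ 1)
    (hz : u z = 0) {r : ℝ} (hr0 : 0 ≤ r) (hr : r < ρ) :
    ∫ t in (-π)..π, u (circlePoint z r t) = 0 := by
  have hlt : ∀ s ∈ Icc 0 r, |s| < ρ := fun s hs => by
    rw [abs_of_nonneg hs.1]; exact hs.2.trans_lt hr
  set m : ℝ → ℝ := fun s => ∫ t in (-π)..π, u (circlePoint z s t) with hm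
  set q : ℝ → ℝ := fun s => ∫ t in (-π)..π,
    (v (circlePoint z s t) * cos t + w (circlePoint z s t) * sin t) with hq
  have hmd : ∀ s ∈ Icc 0 r, HasDerivAt m (-lam * q s) s := fun s hs => h.hasDerivAt_mean (hlt s hs)
  have hqd : ∀ s ∈ Icc 0 r, HasDerivAt (fun s => s * q s) (lam * s * m s) s :=
    fun s hs => h.hasDerivAt_flux (hlt s hs)
  have hmc : ContinuousOn m (Icc 0 r) := fun s hs => (hmd s hs).continuousAt.continuousWithinAt
  -- With `m' = -lam q`, `(s q)' = lam s m` and `m 0 = 0`, two integrations give `|m s₀| ≤ (|lam|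
  -- s₀)² |m s₀|` at a maximum `s₀` of `|m|`. As `|lam| s₀ < 1`, this forces `m = 0`.
  obtain ⟨s₀, hs₀, hmax⟩ := isCompact_Icc.exists_isMaxOn (nonempty_Icc.2 hr0) hmc.abs
  have hmax' : ∀ s ∈ Icc 0 r, |m s| ≤ |m s₀| := fun s hs => hmax hs
  have hm0 : m 0 = 0 := by simp [hm, circlePoint, hz]
  have hq0 : q 0 = 0 := by
    simp [hq, circlePoint]
  have hqb : ∀ s ∈ Icc 0 r, |q s| ≤ |lam| * |m s₀| * s := by
    intro s hs
    rcases hs.1.eq_or_lt with rfl | hpos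
    · simp [hq0]
    have hsub : Icc 0 s ⊆ Icc 0 r := Icc_subset_Icc_right hs.2
    have := norm_image_sub_le_of_norm_deriv_le_segment' (f := fun s => s * q s)
      (C := |lam| * |m s₀| * s)
      (fun x hx => (hqd x (hsub hx)).hasDerivWithinAt)
      (fun x hx => by
        have hx' : x ∈ Icc 0 s := Ico_subset_Icc_self hx
        rw [Real.norm_eq_abs, abs_mul, abs_mul, abs_of_nonneg hx'.1]
        have := hmax' x (hsub hx')
        calc |lam| * x * |m x| ≤ |lam| * s * |m s₀| := by
              gcongr
              exact hx'.2
          _ = |lam| * |m s₀| * s := by ring)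
      s ⟨hs.1, le_rfl⟩
    simp only [zero_mul, sub_zero, Real.norm_eq_abs, abs_mul, abs_of_pos hpos] at this
    have h3 : s * |q s| ≤ s * (|lam| * |m s₀| * s) := by linarith
    exact le_of_mul_le_mul_left h3 hpos
  have hsub : Icc 0 s₀ ⊆ Icc 0 r := Icc_subset_Icc_right hs₀.2
  have key := norm_image_sub_le_of_norm_deriv_le_segment' (f := m)
    (C := |lam| * (|lam| * |m s₀| * s₀))
    (fun x hx => (hmd x (hsub hx)).hasDerivWithinAt)
    (fun x hx => by
      have hx' : x ∈ Icc 0 s₀ := Ico_subset_Icc_self hx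
      rw [Real.norm_eq_abs, abs_mul, abs_neg]
      gcongr
      exact (hqb x (hsub hx')).trans (by gcongr; exact hx'.2))
    s₀ ⟨hs₀.1, le_rfl⟩
  rw [hm0, sub_zero, sub_zero, Real.norm_eq_abs] at key
  have hlam : |lam| * s₀ < 1 ∨ lam = 0 := by
    rcases eq_or_ne lam 0 with h0 | h0
    · exact Or.inr h0
    · exact Or.inl ((mul_lt_mul_of_pos_left (hs₀.2.trans_lt hr) (abs_pos.2 h0)).trans_le hρ)
  have hms : |m s₀| = 0 := by
    rcases hlam with h1 | h1
    · by_contra hne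
      have hpos : 0 < |m s₀| := lt_of_le_of_ne (abs_nonneg _) (Ne.symm hne)
      have h0 : 0 ≤ |lam| * s₀ := mul_nonneg (abs_nonneg _) hs₀.1
      have h2 : (|lam| * s₀) * (|lam| * s₀) < 1 := by nlinarith
      nlinarith
    · simp only [h1, abs_zero, zero_mul] at key
      exact le_antisymm key (abs_nonneg _)
  exact abs_eq_zero.1 (le_antisymm ((hmax' r ⟨hr0, le_rfl⟩).trans hms.le) (abs_nonneg _))

end HelmholtzSystem

/-! ### Radial averages in polar coordinates. -/

/-- A function of the Euclidean distance to the origin, as a function on the plane. -/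
def radial (ψ : ℝ → ℝ) (p : ℝ × ℝ) : ℝ := ψ (p.1 ^ 2 + p.2 ^ 2)

theorem radial_neg (ψ : ℝ → ℝ) (p : ℝ × ℝ) : radial ψ (-p) = radial ψ p := by
  simp [radial]

section Radial

variable {ψ : ℝ → ℝ} {δ ρ : ℝ} {z : ℝ × ℝ} {f : ℝ × ℝ → ℝ}

theorem support_radial_subset (hδ : 0 ≤ δ) (hψ0 : ∀ s, δ ^ 2 ≤ s → ψ s = 0) :
    Function.support (radial ψ) ⊆ Metric.closedBall 0 δ := by
  intro p hp
  have h : p.1 ^ 2 + p.2 ^ 2 < δ ^ 2 := not_le.1 fun h => hp (hψ0 _ h)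
  rw [Metric.mem_closedBall, dist_zero_right, Prod.norm_def, max_le_iff]
  exact ⟨abs_le_of_sq_le_sq (by nlinarith [sq_nonneg p.2]) hδ,
    abs_le_of_sq_le_sq (by nlinarith [sq_nonneg p.1]) hδ⟩

theorem tsupport_radial_subset (hδ : 0 ≤ δ) (hψ0 : ∀ s, δ ^ 2 ≤ s → ψ s = 0) :
    tsupport (radial ψ) ⊆ Metric.closedBall 0 δ :=
  closure_minimal (support_radial_subset hδ hψ0) Metric.isClosed_closedBall

theorem hasCompactSupport_radial (hδ : 0 ≤ δ) (hψ0 : ∀ s, δ ^ 2 ≤ s → ψ s = 0) :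
    HasCompactSupport (radial ψ) :=
  (isCompact_closedBall (0 : ℝ × ℝ) δ).of_isClosed_subset (isClosed_tsupport _)
    (tsupport_radial_subset hδ hψ0)

/-- The radial factor vanishes near the boundary of the ball, so the values of `f` outside do not
matter. -/
theorem continuous_radial_mul (hψ : Continuous ψ) (hδ : 0 ≤ δ) (hδρ : δ < ρ)
    (hψ0 : ∀ s, δ ^ 2 ≤ s → ψ s = 0) (hf : ContinuousOn f (Metric.ball z ρ)) :
    Continuous fun p => radial ψ p * f (z + p) := by
  refine ContinuousOn.continuous_of_tsupport_subset (s := Metric.ball 0 ρ) ?_ Metric.isOpen_ball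
    ((tsupport_mul_subset_left).trans ((tsupport_radial_subset hδ hψ0).trans
      (Metric.closedBall_subset_ball hδρ)))
  refine ContinuousOn.mul (by unfold radial; fun_prop) (hf.comp (by fun_prop) ?_)
  intro p hp
  simpa using hp

theorem integrable_radial_mul (hψ : Continuous ψ) (hδ : 0 ≤ δ) (hδρ : δ < ρ)
    (hψ0 : ∀ s, δ ^ 2 ≤ s → ψ s = 0) (hf : ContinuousOn f (Metric.ball z ρ)) :
    Integrable fun p => radial ψ p * f (z + p) :=
  (continuous_radial_mul hψ hδ hδρ hψ0 hf).integrable_of_hasCompactSupport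
    ((hasCompactSupport_radial hδ hψ0).mul_right)

theorem integral_radial_mul_eq_zero (hψ : Continuous ψ) (hδ : 0 ≤ δ) (hδρ : δ < ρ)
    (hψ0 : ∀ s, δ ^ 2 ≤ s → ψ s = 0) (hf : ContinuousOn f (Metric.ball z ρ))
    (hmean : ∀ r, 0 ≤ r → r < ρ → ∫ t in (-π)..π, f (circlePoint z r t) = 0) :
    ∫ p, radial ψ p * f (z + p) = 0 := by
  have hcont := continuous_radial_mul hψ hδ hδρ hψ0 hf
  rw [← integral_comp_polarCoord_symm]
  have hpol : ∀ p : ℝ × ℝ, p.1 • (radial ψ (polarCoord.symm p) * f (z + polarCoord.symm p)) =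
      p.1 * ψ (p.1 ^ 2) * f (circlePoint z p.1 p.2) := by
    intro p
    have h1 : radial ψ (polarCoord.symm p) = ψ (p.1 ^ 2) := by
      rw [radial, polarCoord_symm_apply]
      congr 1
      linear_combination p.1 ^ 2 * sin_sq_add_cos_sq p.2
    have h2 : z + polarCoord.symm p = circlePoint z p.1 p.2 := by
      rw [polarCoord_symm_apply]; rfl
    rw [h1, h2, smul_eq_mul, mul_assoc]
  have hint : IntegrableOn
      (fun p : ℝ × ℝ => p.1 • (radial ψ (polarCoord.symm p) * f (z + polarCoord.symm p)))
      (Ioi 0 ×ˢ Ioo (-π) π) := by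
    -- The integrand vanishes for radii beyond `δ`, so integrability only has to be checked on a
    -- compact rectangle.
    refine IntegrableOn.of_forall_sdiff_eq_zero (s := Icc 0 δ ×ˢ Icc (-π) π) ?_
      (measurableSet_Ioi.prod measurableSet_Ioo) ?_
    · have hk : Continuous
          (fun p : ℝ × ℝ => p.1 • (radial ψ (polarCoord.symm p) * f (z + polarCoord.symm p))) :=
        continuous_fst.smul (hcont.comp continuous_polarCoord_symm)
      exact hk.continuousOn.integrableOn_compact (isCompact_Icc.prod isCompact_Icc)
    · rintro p ⟨hp, hp'⟩
      rw [hpol]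
      have hpos : 0 < p.1 := hp.1
      have : δ < p.1 := by
        by_contra hle
        exact hp' ⟨⟨hpos.le, not_lt.1 hle⟩, Ioo_subset_Icc_self hp.2⟩
      rw [hψ0 _ (by gcongr), mul_zero, zero_mul]
  rw [polarCoord_target]
  rw [Measure.volume_eq_prod] at hint ⊢
  rw [setIntegral_prod _ hint]
  refine setIntegral_eq_zero_of_forall_eq_zero fun r hr => ?_
  have hpos : 0 < r := hr
  have hr' := fun t => hpol (r, t)
  dsimp only at hr'
  simp_rw [hr']
  rw [integral_const_mul]
  rcases lt_or_ge r ρ with h | h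
  · rw [← integral_Ioc_eq_integral_Ioo,
      ← intervalIntegral.integral_of_le (by linarith [pi_pos]), hmean r hpos.le h, mul_zero]
  · rw [hψ0 _ (by gcongr; linarith), mul_zero, zero_mul]

end Radial

/-! ### The mean value property and its constant. -/

namespace HelmholtzSystem

variable {Ω : Set (ℝ × ℝ)} {lam : ℝ} {u v w : ℝ × ℝ → ℝ} {z : ℝ × ℝ} {ρ : ℝ}

/-- Subtracting a multiple of the plane wave `cos (lam (x - x₀))`. -/
theorem sub_planeWave (h : HelmholtzSystem Ω lam u v w) (hΩ : IsOpen Ω) (a x₀ : ℝ) :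
    HelmholtzSystem Ω lam (fun p => u p - a * cos (lam * (p.1 - x₀)))
      (fun p => v p - a * sin (lam * (p.1 - x₀))) w := by
  have harg : ∀ p : ℝ × ℝ, HasFDerivAt (fun p : ℝ × ℝ => lam * (p.1 - x₀))
      (lam • ContinuousLinearMap.fst ℝ ℝ ℝ) p := fun p =>
    (hasFDerivAt_fst.sub_const x₀).const_mul lam
  have hu := fun p (hp : p ∈ Ω) => ((h.contDiffOn_u.differentiableOn one_ne_zero).differentiableAt
      (hΩ.mem_nhds hp)).hasFDerivAt.sub ((harg p).cos.const_mul a)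
  have hv := fun p (hp : p ∈ Ω) => ((h.contDiffOn_v.differentiableOn one_ne_zero).differentiableAt
      (hΩ.mem_nhds hp)).hasFDerivAt.sub ((harg p).sin.const_mul a)
  refine ⟨h.contDiffOn_u.sub ?_, h.contDiffOn_v.sub ?_, h.contDiffOn_w, fun p hp e => ?_,
    fun p hp => ?_⟩
  · exact ContDiff.contDiffOn (by fun_prop)
  · exact ContDiff.contDiffOn (by fun_prop)
  · have := congrArg (fun T : ℝ × ℝ →L[ℝ] ℝ => T e) (hu p hp).fderiv
    simp only [sub_apply, smul_apply,
      ContinuousLinearMap.coe_fst', smul_eq_mul, h.fderiv_u p hp e] at this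
    refine this.trans ?_
    ring
  · have := congrArg (fun T : ℝ × ℝ →L[ℝ] ℝ => T (1, 0)) (hv p hp).fderiv
    simp only [sub_apply, smul_apply,
      ContinuousLinearMap.coe_fst', smul_eq_mul] at this
    have h2 := h.div p hp
    have h3 : fderiv ℝ (fun p : ℝ × ℝ => v p - a * sin (lam * (p.1 - x₀))) p (1, 0) =
      fderiv ℝ v p (1, 0) - a * (cos (lam * (p.1 - x₀)) * (lam * 1)) := this
    rw [h3]
    linear_combination h2

/-- Mean value property: radial averages are multiples of the central value, and the factor does
not depend on the solution. -/
theorem integral_radial_mul (h : HelmholtzSystem (Metric.ball z ρ) lam u v w)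
    (hρ : |lam| * ρ ≤ 1) {ψ : ℝ → ℝ} {δ : ℝ} (hψ : Continuous ψ) (hδ : 0 ≤ δ) (hδρ : δ < ρ)
    (hψ0 : ∀ s, δ ^ 2 ≤ s → ψ s = 0) :
    ∫ p, radial ψ p * u (z + p) = u z * ∫ p, radial ψ p * cos (lam * p.1) := by
  -- The plane wave equals `1` at the centre, so the difference vanishes there and its circular
  -- means are zero. The average of the wave itself supplies the universal factor.
  have h' := h.sub_planeWave Metric.isOpen_ball (u z) z.1
  have h0 := integral_radial_mul_eq_zero hψ hδ hδρ hψ0 h'.contDiffOn_u.continuousOn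
    (fun r hr0 hr => h'.mean_eq_zero hρ (by simp) hr0 hr)
  have hc : ContinuousOn (fun p : ℝ × ℝ => cos (lam * (p.1 - z.1))) (Metric.ball z ρ) := by
    fun_prop
  have i1 := integrable_radial_mul hψ hδ hδρ hψ0 h.contDiffOn_u.continuousOn
  have i2 := integrable_radial_mul hψ hδ hδρ hψ0 hc
  have heq : (fun p : ℝ × ℝ => radial ψ p * (u (z + p) - u z * cos (lam * ((z + p).1 - z.1)))) =
      fun p => radial ψ p * u (z + p) - u z * (radial ψ p * cos (lam * ((z + p).1 - z.1))) := by
    funext p; ring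
  rw [heq, integral_sub i1 (i2.const_mul _), integral_const_mul] at h0
  simp only [Prod.fst_add, add_sub_cancel_left] at h0
  exact sub_eq_zero.1 h0

end HelmholtzSystem

/-- Makes the mean value factor invertible: on the support `|lam * p.1| ≤ 1`, where the cosine is
positive. -/
theorem integral_radial_mul_cos_pos {lam ρ δ : ℝ} (hρ : |lam| * ρ ≤ 1) {ψ : ℝ → ℝ}
    (hψ : Continuous ψ) (hδ : 0 ≤ δ) (hδρ : δ < ρ) (hψ0 : ∀ s, δ ^ 2 ≤ s → ψ s = 0)
    (hnn : ∀ s, 0 ≤ ψ s) (h0 : 0 < ψ 0) : 0 < ∫ p : ℝ × ℝ, radial ψ p * cos (lam * p.1) := by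
  have hcs := hasCompactSupport_radial hδ hψ0
  refine Continuous.integral_pos_of_hasCompactSupport_nonneg_nonzero (x := 0) ?_ ?_ ?_ ?_
  · unfold radial; fun_prop
  · exact hcs.mul_right
  · intro p
    by_cases hp : radial ψ p = 0
    · simp [hp]
    refine mul_nonneg (hnn _) ?_
    have h1 := support_radial_subset hδ hψ0 hp
    rw [Metric.mem_closedBall, dist_zero_right, Prod.norm_def, max_le_iff] at h1
    have h2 : |lam * p.1| ≤ 1 := by
      rw [abs_mul]
      exact (mul_le_mul_of_nonneg_left (h1.1.trans hδρ.le) (abs_nonneg _)).trans hρ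
    exact (cos_pos_of_le_one h2).le
  · simpa [radial] using h0.ne'

/-! ### Quaternion components and reduction to the Helmholtz system. -/

/-- The real part as a continuous linear map. -/
noncomputable def reCLM : ℍ[ℝ] →L[ℝ] ℝ :=
  ⟨QuaternionAlgebra.reₗ (-1 : ℝ) 0 (-1), Quaternion.continuous_re⟩

/-- The `i`-component as a continuous linear map. -/
noncomputable def imICLM : ℍ[ℝ] →L[ℝ] ℝ :=
  ⟨QuaternionAlgebra.imIₗ (-1 : ℝ) 0 (-1), Quaternion.continuous_imI⟩

/-- The `j`-component as a continuous linear map. -/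
noncomputable def imJCLM : ℍ[ℝ] →L[ℝ] ℝ :=
  ⟨QuaternionAlgebra.imJₗ (-1 : ℝ) 0 (-1), Quaternion.continuous_imJ⟩

/-- The `k`-component as a continuous linear map. -/
noncomputable def imKCLM : ℍ[ℝ] →L[ℝ] ℝ :=
  ⟨QuaternionAlgebra.imKₗ (-1 : ℝ) 0 (-1), Quaternion.continuous_imK⟩

theorem reCLM_apply (q : ℍ[ℝ]) : reCLM q = q.re := rfl

theorem imICLM_apply (q : ℍ[ℝ]) : imICLM q = q.imI := rfl

theorem imJCLM_apply (q : ℍ[ℝ]) : imJCLM q = q.imJ := rfl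

theorem imKCLM_apply (q : ℍ[ℝ]) : imKCLM q = q.imK := rfl

theorem re_opD (F : ℝ × ℝ → ℍ[ℝ]) (z : ℝ × ℝ) :
    (opD F z).re = -(fderiv ℝ F z (1, 0)).imI - (fderiv ℝ F z (0, 1)).imJ := by
  rw [opD, Quaternion.re_add, Quaternion.re_mul, Quaternion.re_mul]
  simp only [unitI, unitJ]
  ring

theorem imI_opD (F : ℝ × ℝ → ℍ[ℝ]) (z : ℝ × ℝ) :
    (opD F z).imI = (fderiv ℝ F z (1, 0)).re + (fderiv ℝ F z (0, 1)).imK := by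
  rw [opD, Quaternion.imI_add, Quaternion.imI_mul, Quaternion.imI_mul]
  simp only [unitI, unitJ]
  ring

theorem imJ_opD (F : ℝ × ℝ → ℍ[ℝ]) (z : ℝ × ℝ) :
    (opD F z).imJ = -(fderiv ℝ F z (1, 0)).imK + (fderiv ℝ F z (0, 1)).re := by
  rw [opD, Quaternion.imJ_add, Quaternion.imJ_mul, Quaternion.imJ_mul]
  simp only [unitI, unitJ]
  ring

variable {Ω : Set (ℝ × ℝ)} {lam : ℝ} {F : ℝ × ℝ → ℍ[ℝ]}

theorem helmholtzSystem_of_mem (hΩ : IsOpen Ω) (hF : F ∈ M Ω lam) :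
    HelmholtzSystem Ω lam (fun z => (F z).re) (fun z => (F z).imI) (fun z => (F z).imJ) := by
  obtain ⟨hC, hK, hD⟩ := hF
  have hd := fun z (hz : z ∈ Ω) =>
    ((hC.differentiableOn one_ne_zero).differentiableAt (hΩ.mem_nhds hz)).hasFDerivAt
  have h0 : ∀ z ∈ Ω, ∀ e, fderiv ℝ (fun z => (F z).re) z e = (fderiv ℝ F z e).re :=
    fun z hz e => congrArg (fun T : ℝ × ℝ →L[ℝ] ℝ => T e)
      (reCLM.hasFDerivAt.comp z (hd z hz)).fderiv
  have h1 : ∀ z ∈ Ω, ∀ e, fderiv ℝ (fun z => (F z).imI) z e = (fderiv ℝ F z e).imI :=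
    fun z hz e => congrArg (fun T : ℝ × ℝ →L[ℝ] ℝ => T e)
      (imICLM.hasFDerivAt.comp z (hd z hz)).fderiv
  have h2 : ∀ z ∈ Ω, ∀ e, fderiv ℝ (fun z => (F z).imJ) z e = (fderiv ℝ F z e).imJ :=
    fun z hz e => congrArg (fun T : ℝ × ℝ →L[ℝ] ℝ => T e)
      (imJCLM.hasFDerivAt.comp z (hd z hz)).fderiv
  -- The `k`-component vanishes on an open set, hence so do its derivatives; this removes them from
  -- the `i`- and `j`-equations.
  have h3 : ∀ z ∈ Ω, ∀ e, (fderiv ℝ F z e).imK = 0 := fun z hz e => by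
    have hc : HasFDerivAt (fun z => (F z).imK) (0 : ℝ × ℝ →L[ℝ] ℝ) z :=
      (hasFDerivAt_const (0 : ℝ) z).congr_of_eventuallyEq
        (by filter_upwards [hΩ.mem_nhds hz] with p hp using hK p hp)
    exact congrArg (fun T : ℝ × ℝ →L[ℝ] ℝ => T e)
      ((imKCLM.hasFDerivAt.comp z (hd z hz)).unique hc)
  refine ⟨reCLM.contDiff.comp_contDiffOn hC, imICLM.contDiff.comp_contDiffOn hC,
    imJCLM.contDiff.comp_contDiffOn hC, fun z hz e => ?_, fun z hz => ?_⟩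
  · have hDi := congrArg QuaternionAlgebra.imI (hD z hz)
    have hDj := congrArg QuaternionAlgebra.imJ (hD z hz)
    simp only [Quaternion.imI_add, Quaternion.imJ_add, imI_opD, imJ_opD, Quaternion.imI_smul,
      Quaternion.imJ_smul, h3 z hz, smul_eq_mul, Quaternion.imI_zero, Quaternion.imJ_zero]
      at hDi hDj
    obtain ⟨a, b⟩ := e
    rw [fderiv_apply_prod, h0 z hz, h0 z hz]
    linear_combination a * hDi + b * hDj
  · have hDr := congrArg QuaternionAlgebra.re (hD z hz)
    simp only [Quaternion.re_add, re_opD, Quaternion.re_smul, smul_eq_mul, Quaternion.re_zero]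
      at hDr
    rw [h1 z hz, h2 z hz]
    linear_combination -hDr

/-! ### The reproducing kernel. -/

open scoped Convolution
open ContinuousLinearMap (lsmul)

/-- The first component of `F`, cut off to the closed ball. -/
noncomputable def cutRe (F : ℝ × ℝ → ℍ[ℝ]) (z : ℝ × ℝ) (r : ℝ) : ℝ × ℝ → ℝ :=
  (Metric.closedBall z r).indicator fun p => (F p).re

theorem integrable_cutRe {z : ℝ × ℝ} {r : ℝ} (hF : ContinuousOn F (Metric.closedBall z r)) :
    Integrable (cutRe F z r) :=
  ((Quaternion.continuous_re.comp_continuousOn hF).integrableOn_compact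
    (isCompact_closedBall z r)).integrable_indicator Metric.isClosed_closedBall.measurableSet

theorem clm_convolution_apply {g : ℝ × ℝ → ℝ} (hg : Integrable g) {Φ : ℝ × ℝ → ℍ[ℝ]}
    (hΦ : Continuous Φ) (hΦc : HasCompactSupport Φ) (T : ℍ[ℝ] →L[ℝ] ℝ) (z : ℝ × ℝ) :
    T ((g ⋆[lsmul ℝ ℝ, volume] Φ) z) = (g ⋆[lsmul ℝ ℝ, volume] fun t => T (Φ t)) z := by
  have := hΦc.convolutionExists_right (lsmul ℝ ℝ) hg.locallyIntegrable hΦ z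
  rw [convolution_def, convolution_def, ← T.integral_comp_comm this]
  simp

/-- The kernel is even, so after a translation the convolution is a radial average about `z`. The
radius `2 * ε` leaves room for `z` (within `ε` of `z₀`) plus the support of the kernel, so the
cut-off is not seen. -/
theorem cutRe_convolution_radial (hΩ : IsOpen Ω) (hF : F ∈ M Ω lam) {ε : ℝ}
    (hle : |lam| * ε ≤ 1) {ψ : ℝ → ℝ} {δ : ℝ} (hψ : Continuous ψ) (hδ : 0 ≤ δ) (hδε : δ < ε)
    (hψ0 : ∀ s, δ ^ 2 ≤ s → ψ s = 0) {z₀ z : ℝ × ℝ} (hsub : Metric.closedBall z₀ (2 * ε) ⊆ Ω)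
    (hz : z ∈ Metric.ball z₀ ε) :
    (cutRe F z₀ (2 * ε) ⋆[lsmul ℝ ℝ, volume] radial ψ) z =
      (F z).re * ∫ p : ℝ × ℝ, radial ψ p * cos (lam * p.1) := by
  have hmem : ∀ p ∈ Metric.ball (0 : ℝ × ℝ) ε, z + p ∈ Metric.closedBall z₀ (2 * ε) := by
    intro p hp
    rw [Metric.mem_ball, dist_zero_right] at hp
    rw [Metric.mem_ball, dist_eq_norm] at hz
    rw [Metric.mem_closedBall, dist_eq_norm, show z + p - z₀ = (z - z₀) + p by abel]
    linarith [norm_add_le (z - z₀) p]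
  have hball : Metric.ball z ε ⊆ Ω := fun p hp => hsub <| by
    have := hmem (p - z) (by rwa [Metric.mem_ball, dist_zero_right, ← dist_eq_norm])
    rwa [add_sub_cancel] at this
  rw [← ((helmholtzSystem_of_mem hΩ hF).mono hball).integral_radial_mul hle hψ hδ hδε hψ0,
    convolution_def, ← integral_add_left_eq_self _ z]
  refine integral_congr_ae (Eventually.of_forall fun p => ?_)
  simp only [ContinuousLinearMap.lsmul_apply, smul_eq_mul, sub_add_cancel_left, radial_neg]
  by_cases hp : radial ψ p = 0
  · simp [hp]
  · rw [cutRe, indicator_of_mem (hmem p (Metric.closedBall_subset_ball hδε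
      (support_radial_subset hδ hψ0 hp))), mul_comm]

/-- Metamonogenic functions are locally convolutions of their first component with a kernel that
does not depend on the function. -/
theorem exists_reproducing_kernel (hlam : lam ≠ 0) {ε : ℝ} (hε : 0 < ε) (hle : |lam| * ε ≤ 1) :
    ∃ Φ : ℝ × ℝ → ℍ[ℝ], ContDiff ℝ 1 Φ ∧ HasCompactSupport Φ ∧
      ∀ (Ω : Set (ℝ × ℝ)) (F : ℝ × ℝ → ℍ[ℝ]) (z₀ : ℝ × ℝ), IsOpen Ω → F ∈ M Ω lam →
        Metric.closedBall z₀ (2 * ε) ⊆ Ω → ∀ z ∈ Metric.ball z₀ ε,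
          F z = (cutRe F z₀ (2 * ε) ⋆[lsmul ℝ ℝ, volume] Φ) z := by
  -- The bump is evaluated at the squared distance, so its outer radius is the square of the support
  -- radius `ε / 2`.
  let b : ContDiffBump (0 : ℝ) := ⟨(ε / 2) ^ 2 / 2, (ε / 2) ^ 2, by positivity,
    half_lt_self (by positivity)⟩
  have hδ : 0 ≤ ε / 2 := by positivity
  have hδε : ε / 2 < ε := half_lt_self hε
  have hψ0 : ∀ s, (ε / 2) ^ 2 ≤ s → b s = 0 := fun s hs => b.zero_of_le_dist (by
    rw [Real.dist_eq, sub_zero]; exact hs.trans (le_abs_self s))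
  set φ : ℝ × ℝ → ℝ := radial b with hφ
  have hφd : ContDiff ℝ 2 φ := by
    have : ContDiff ℝ 2 fun p : ℝ × ℝ => p.1 ^ 2 + p.2 ^ 2 := by fun_prop
    exact b.contDiff.comp this
  have hφc : HasCompactSupport φ := hasCompactSupport_radial hδ hψ0
  have hφ' : ContDiff ℝ 1 (fderiv ℝ φ) := hφd.fderiv_right (by norm_num)
  set c := ∫ p : ℝ × ℝ, radial b p * cos (lam * p.1) with hc
  have hcpos : 0 < c := integral_radial_mul_cos_pos hle b.continuous hδ hδε hψ0
    (fun _ => b.nonneg) (b.pos_of_mem_ball (Metric.mem_ball_self b.rOut_pos))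
  have hpd : ∀ e, ContDiff ℝ 1 (fun t => fderiv ℝ φ t e) := fun e => hφ'.clm_apply contDiff_const
  have hpc : ∀ e, HasCompactSupport (fun t => fderiv ℝ φ t e) := fun e => hφc.fderiv_apply ℝ e
  -- The `i`- and `j`-parts encode `v = -lam⁻¹ ∂u/∂x` and `w = -lam⁻¹ ∂u/∂y`, with the derivatives
  -- moved onto `φ`; hence `φ` is taken `C²`.
  let Ψ : ℝ × ℝ → ℍ[ℝ] := fun t => φ t • (1 : ℍ[ℝ]) +
    (fderiv ℝ φ t (1, 0) • ((-lam⁻¹) • unitI) + fderiv ℝ φ t (0, 1) • ((-lam⁻¹) • unitJ))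
  have hΨd : ContDiff ℝ 1 Ψ := ((hφd.of_le (by norm_num)).smul contDiff_const).add
    (((hpd _).smul contDiff_const).add ((hpd _).smul contDiff_const))
  have hΨc : HasCompactSupport Ψ := hφc.smul_right.add ((hpc _).smul_right.add (hpc _).smul_right)
  refine ⟨c⁻¹ • Ψ, contDiff_const.smul hΨd, hΨc.smul_left (f := fun _ => c⁻¹), ?_⟩
  intro Ω F z₀ hΩ hF hsub z hz
  set g := cutRe F z₀ (2 * ε) with hg
  have hgi : Integrable g := integrable_cutRe (hF.1.continuousOn.mono hsub)
  have hrep : ∀ p ∈ Metric.ball z₀ ε, (F p).re = c⁻¹ * (g ⋆[lsmul ℝ ℝ, volume] φ) p := by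
    intro p hp
    rw [cutRe_convolution_radial hΩ hF hle b.continuous hδ hδε hψ0 hsub hp]
    change _ = c⁻¹ * (_ * c)
    field_simp
  have hder : ∀ e, fderiv ℝ (fun p => (F p).re) z e =
      c⁻¹ * (g ⋆[lsmul ℝ ℝ, volume] fun t => fderiv ℝ φ t e) z := by
    intro e
    have h1 := (hφc.hasFDerivAt_convolution_right (lsmul ℝ ℝ) hgi.locallyIntegrable
      (hφd.of_le (by norm_num)) z).const_mul c⁻¹
    have h2 := h1.congr_of_eventuallyEq (f₁ := fun p => (F p).re)
      (by filter_upwards [Metric.isOpen_ball.mem_nhds hz] with p hp using hrep p hp)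
    rw [h2.fderiv, smul_apply, smul_eq_mul,
      convolution_precompR_apply _ hgi.locallyIntegrable (hφc.fderiv ℝ) hφ'.continuous]
  have hzΩ : z ∈ Ω := hsub (Metric.ball_subset_closedBall
    (Metric.ball_subset_ball (by linarith) hz))
  have hsys := (helmholtzSystem_of_mem hΩ hF).fderiv_u z hzΩ
  have hcomp := fun T => clm_convolution_apply hgi hΨd.continuous hΨc T z
  have hsm : ∀ (a : ℝ) (k : ℝ × ℝ → ℝ), (g ⋆[lsmul ℝ ℝ, volume] fun t => a * k t) z =
      a * (g ⋆[lsmul ℝ ℝ, volume] k) z := fun a k =>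
    congrFun (convolution_smul (L := lsmul ℝ ℝ) (f := g) (g := k) (y := a)) z
  rw [convolution_smul, Pi.smul_apply]
  ext
  · refine (hrep z hz).trans (congrArg (c⁻¹ * ·) ?_)
    refine Eq.trans ?_ (hcomp reCLM).symm
    congr 1
    funext t
    simp only [Ψ, map_add, map_smul, reCLM_apply]
    simp [unitI, unitJ]
  · refine Eq.trans ?_ (congrArg (c⁻¹ * ·) (hcomp imICLM).symm)
    have : (fun t => imICLM (Ψ t)) = fun t => -lam⁻¹ * fderiv ℝ φ t (1, 0) := by
      funext t
      simp only [Ψ, map_add, map_smul, imICLM_apply]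
      simp [unitI, unitJ, mul_comm]
    have h1 := (hsys (1, 0)).symm.trans (hder (1, 0))
    simp only [this, hsm]
    field_simp at h1 ⊢
    linarith
  · refine Eq.trans ?_ (congrArg (c⁻¹ * ·) (hcomp imJCLM).symm)
    have : (fun t => imJCLM (Ψ t)) = fun t => -lam⁻¹ * fderiv ℝ φ t (0, 1) := by
      funext t
      simp only [Ψ, map_add, map_smul, imJCLM_apply]
      simp [unitI, unitJ, mul_comm]
    have h1 := (hsys (0, 1)).symm.trans (hder (0, 1))
    simp only [this, hsm]
    field_simp at h1 ⊢
    linarith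
  · refine (hF.2.1 z hzΩ).trans ?_
    refine Eq.trans ?_ (congrArg (c⁻¹ * ·) (hcomp imKCLM).symm)
    have : (fun t => imKCLM (Ψ t)) = 0 := by
      funext t
      simp only [Ψ, map_add, map_smul, imKCLM_apply]
      simp [unitI, unitJ]
    simp [this]

end Metamonogenic

/-! ### Passage to the limit and the local `L²` bound. -/

namespace Metamonogenic

open Set Real
open scoped Convolution ENNReal
open ContinuousLinearMap (lsmul)

variable {Ω : Set (ℝ × ℝ)} {lam : ℝ}

theorem norm_re_le_norm (q : ℍ[ℝ]) : ‖q.re‖ ≤ ‖q‖ := by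
  refine abs_le_of_sq_le_sq ?_ (norm_nonneg q)
  rw [sq ‖q‖, ← Quaternion.normSq_eq_norm_mul_self, Quaternion.normSq_def']
  nlinarith [sq_nonneg q.imI, sq_nonneg q.imJ, sq_nonneg q.imK]

theorem exists_closedBall_subset (hΩ : IsOpen Ω) (lam : ℝ) {z : ℝ × ℝ} (hz : z ∈ Ω) :
    ∃ ε > 0, |lam| * ε ≤ 1 ∧ Metric.closedBall z (2 * ε) ⊆ Ω := by
  obtain ⟨r, hr, hsub⟩ := Metric.nhds_basis_closedBall.mem_iff.1 (hΩ.mem_nhds hz)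
  refine ⟨min (r / 2) (1 / (|lam| + 1)), by positivity, ?_, ?_⟩
  · calc |lam| * min (r / 2) (1 / (|lam| + 1)) ≤ |lam| * (1 / (|lam| + 1)) := by
          gcongr; exact min_le_right _ _
      _ ≤ 1 := by
          rw [mul_one_div, div_le_one (by positivity)]; linarith
  · refine (Metric.closedBall_subset_closedBall ?_).trans hsub
    linarith [min_le_left (r / 2) (1 / (|lam| + 1))]

/-- Convolutions with a fixed kernel pass to the limit under uniform convergence on the ball. -/
theorem tendsto_cutRe_convolution {E E' : Type*} [NormedAddCommGroup E] [NormedSpace ℝ E]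
    [NormedAddCommGroup E'] [NormedSpace ℝ E'] (L : ℝ →L[ℝ] E →L[ℝ] E')
    {F : ℕ → ℝ × ℝ → ℍ[ℝ]} {G : ℝ × ℝ → ℍ[ℝ]} {z₀ : ℝ × ℝ} {r : ℝ}
    (hF : ∀ n, ContinuousOn (F n) (Metric.closedBall z₀ r))
    (h : TendstoUniformlyOn F G atTop (Metric.closedBall z₀ r))
    {Φ : ℝ × ℝ → E} (hΦ : Continuous Φ) (hΦc : HasCompactSupport Φ) (z : ℝ × ℝ) :
    Tendsto (fun n => (cutRe (F n) z₀ r ⋆[L, volume] Φ) z) atTop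
      (𝓝 ((cutRe G z₀ r ⋆[L, volume] Φ) z)) := by
  have hG : ContinuousOn G (Metric.closedBall z₀ r) := h.continuousOn (.of_forall hF)
  obtain ⟨C, hC⟩ := (isCompact_closedBall z₀ r).exists_bound_of_continuousOn hG
  obtain ⟨C', hC'⟩ := hΦ.bounded_above_of_compact_support hΦc
  simp only [convolution_def]
  refine tendsto_integral_filter_of_dominated_convergence
    ((Metric.closedBall z₀ r).indicator fun _ => ‖L‖ * (C + 1) * C') ?_ ?_ ?_ ?_
  · exact .of_forall fun n => (hΦc.convolutionExists_right L
      (integrable_cutRe (hF n)).locallyIntegrable hΦ z).aestronglyMeasurable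
  -- Eventually `F n` is within `1` of `G` on the ball, which explains the bound `C + 1`.
  · filter_upwards [Metric.tendstoUniformlyOn_iff.1 h 1 one_pos] with n hn
    refine .of_forall fun t => ?_
    by_cases ht : t ∈ Metric.closedBall z₀ r
    · rw [cutRe, indicator_of_mem ht, indicator_of_mem ht]
      have h1 : ‖(F n t).re‖ ≤ C + 1 := by
        have h2 := hn t ht
        rw [dist_comm, dist_eq_norm] at h2
        have h3 := norm_le_norm_add_norm_sub' (F n t) (G t)
        have h4 : ‖(F n t).re‖ ≤ ‖F n t‖ := norm_re_le_norm _
        linarith [hC t ht]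
      have h5 : 0 ≤ C + 1 := (norm_nonneg _).trans h1
      exact (L.le_opNorm₂ _ _).trans (by gcongr; exact hC' _)
    · simp [cutRe, indicator_of_notMem ht]
  · exact (integrableOn_const (measure_closedBall_lt_top).ne).integrable_indicator
      Metric.isClosed_closedBall.measurableSet
  · refine .of_forall fun t => ?_
    have h1 : Tendsto (fun n => cutRe (F n) z₀ r t) atTop (𝓝 (cutRe G z₀ r t)) := by
      by_cases ht : t ∈ Metric.closedBall z₀ r
      · simp only [cutRe, indicator_of_mem ht]
        exact (Quaternion.continuous_re.tendsto _).comp (h.tendsto_at ht)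
      · simp [cutRe, indicator_of_notMem ht]
    exact ((L.flip (Φ (z - t))).continuous.tendsto _).comp h1

/-- Locally uniform limits of metamonogenic functions are metamonogenic. -/
theorem mem_of_tendstoUniformlyOn (hΩ : IsOpen Ω) (hlam : lam ≠ 0) {F : ℕ → ℝ × ℝ → ℍ[ℝ]}
    {G : ℝ × ℝ → ℍ[ℝ]} (hF : ∀ n, F n ∈ M Ω lam)
    (h : ∀ K ⊆ Ω, IsCompact K → TendstoUniformlyOn F G atTop K) : G ∈ M Ω lam := by
  have hlim : ∀ z ∈ Ω, Tendsto (fun n => F n z) atTop (𝓝 (G z)) := fun z hz =>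
    (h {z} (singleton_subset_iff.2 hz) isCompact_singleton).tendsto_at rfl
  have main : ∀ z ∈ Ω, ContDiffAt ℝ 1 G z ∧
      Tendsto (fun n => fderiv ℝ (F n) z) atTop (𝓝 (fderiv ℝ G z)) := by
    intro z hz
    obtain ⟨ε, hε, hle, hsub⟩ := exists_closedBall_subset hΩ lam hz
    obtain ⟨Φ, hΦd, hΦc, hrep⟩ := exists_reproducing_kernel hlam hε hle
    have hu := h _ hsub (isCompact_closedBall _ _)
    have hFc : ∀ n, ContinuousOn (F n) (Metric.closedBall z (2 * ε)) := fun n =>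
      (hF n).1.continuousOn.mono hsub
    have hgF := fun n => (integrable_cutRe (hFc n)).locallyIntegrable
    have hgG := (integrable_cutRe (hu.continuousOn (.of_forall hFc))).locallyIntegrable
    have hball : Metric.ball z ε ∈ 𝓝 z := Metric.ball_mem_nhds z hε
    have hrepF : ∀ n, F n =ᶠ[𝓝 z] cutRe (F n) z (2 * ε) ⋆[lsmul ℝ ℝ, volume] Φ := fun n => by
      filter_upwards [hball] with p hp using hrep Ω (F n) z hΩ (hF n) hsub p hp
    -- The limit inherits the representation, and with it `C¹` regularity.
    have hrepG : G =ᶠ[𝓝 z] cutRe G z (2 * ε) ⋆[lsmul ℝ ℝ, volume] Φ := by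
      filter_upwards [hball] with p hp
      have hpΩ : p ∈ Ω := hsub (Metric.ball_subset_closedBall
        (Metric.ball_subset_ball (by linarith) hp))
      refine tendsto_nhds_unique (hlim p hpΩ) ?_
      simp only [fun n => hrep Ω (F n) z hΩ (hF n) hsub p hp]
      exact tendsto_cutRe_convolution _ hFc hu hΦd.continuous hΦc p
    refine ⟨(hΦc.contDiff_convolution_right (n := 1) _ hgG hΦd).contDiffAt.congr_of_eventuallyEq
      hrepG, ?_⟩
    have hdF := fun n => ((hΦc.hasFDerivAt_convolution_right (lsmul ℝ ℝ) (hgF n) hΦd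
      z).congr_of_eventuallyEq (hrepF n)).fderiv
    have hdG := ((hΦc.hasFDerivAt_convolution_right (lsmul ℝ ℝ) hgG hΦd
      z).congr_of_eventuallyEq hrepG).fderiv
    simp only [hdF, hdG]
    -- The derivatives are convolutions with `fderiv ℝ Φ`, so the same limit lemma applies to this
    -- operator-valued kernel.
    exact tendsto_cutRe_convolution _ hFc hu (hΦd.continuous_fderiv one_ne_zero)
      (hΦc.fderiv ℝ) z
  refine ⟨fun z hz => (main z hz).1.contDiffWithinAt, fun z hz => ?_, fun z hz => ?_⟩
  · refine tendsto_nhds_unique ((Quaternion.continuous_imK.tendsto _).comp (hlim z hz)) ?_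
    simp [Function.comp_def, fun n => (hF n).2.1 z hz]
  · have hd := (main z hz).2
    have happ : ∀ e, Tendsto (fun n => fderiv ℝ (F n) z e) atTop (𝓝 (fderiv ℝ G z e)) := fun e =>
      ((ContinuousLinearMap.apply ℝ ℍ[ℝ] e).continuous.tendsto _).comp hd
    have hD : Tendsto (fun n => opD (F n) z + lam • F n z) atTop (𝓝 (opD G z + lam • G z)) :=
      (((happ _).const_mul _).add ((happ _).const_mul _)).add ((hlim z hz).const_smul lam)
    refine tendsto_nhds_unique hD ?_
    simp [fun n => (hF n).2.2 z hz]

theorem sub_mem (hΩ : IsOpen Ω) {F G : ℝ × ℝ → ℍ[ℝ]} (hF : F ∈ M Ω lam) (hG : G ∈ M Ω lam) :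
    F - G ∈ M Ω lam := by
  refine ⟨hF.1.sub hG.1, fun z hz => ?_, fun z hz => ?_⟩
  · rw [Pi.sub_apply, Quaternion.imK_sub, hF.2.1 z hz, hG.2.1 z hz, sub_zero]
  · have hd : ∀ {H : ℝ × ℝ → ℍ[ℝ]}, H ∈ M Ω lam → DifferentiableAt ℝ H z := fun hH =>
      (hH.1.differentiableOn one_ne_zero).differentiableAt (hΩ.mem_nhds hz)
    have h1 := hF.2.2 z hz
    have h2 := hG.2.2 z hz
    rw [opD] at h1 h2 ⊢
    rw [fderiv_sub (hd hF) (hd hG), sub_apply, sub_apply, Pi.sub_apply, mul_sub, mul_sub,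
      smul_sub, ← sub_zero (0 : ℍ[ℝ])]
    nth_rewrite 1 [← h1]
    rw [← h2]
    abel

/-- Locally, the values of a metamonogenic function are bounded by its `L²` norm. -/
theorem exists_enorm_le_mul_eLpNorm (hΩ : IsOpen Ω) (hlam : lam ≠ 0) {z₀ : ℝ × ℝ} (hz₀ : z₀ ∈ Ω) :
    ∃ ε > 0, ∃ C : ℝ≥0∞, C ≠ ∞ ∧ ∀ F ∈ M Ω lam, ∀ z ∈ Metric.ball z₀ ε,
      ‖F z‖ₑ ≤ C * eLpNorm F 2 (volume.restrict Ω) := by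
  obtain ⟨ε, hε, hle, hsub⟩ := exists_closedBall_subset hΩ lam hz₀
  obtain ⟨Φ, hΦd, hΦc, hrep⟩ := exists_reproducing_kernel hlam hε hle
  obtain ⟨C, hC⟩ := hΦd.continuous.bounded_above_of_compact_support hΦc
  set B := Metric.closedBall z₀ (2 * ε) with hB
  have hBm : MeasurableSet B := Metric.isClosed_closedBall.measurableSet
  refine ⟨ε, hε, ENNReal.ofReal C * volume B ^ (1 / (1 : ℝ≥0∞).toReal - 1 / (2 : ℝ≥0∞).toReal),
    ENNReal.mul_ne_top ENNReal.ofReal_ne_top (ENNReal.rpow_ne_top_of_nonneg (by norm_num)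
      measure_closedBall_lt_top.ne), fun F hF z hz => ?_⟩
  have hmeas : AEStronglyMeasurable F (volume.restrict B) :=
    (hF.1.continuousOn.mono hsub).aestronglyMeasurable hBm
  -- Hölder on the finite-measure ball `B`, followed by enlarging `B` to `Ω`.
  have h1 : eLpNorm F 1 (volume.restrict B) ≤ eLpNorm F 2 (volume.restrict Ω) *
      volume B ^ (1 / (1 : ℝ≥0∞).toReal - 1 / (2 : ℝ≥0∞).toReal) := by
    refine (eLpNorm_le_eLpNorm_mul_rpow_measure_univ one_le_two hmeas).trans ?_
    rw [Measure.restrict_apply_univ]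
    gcongr
  have h2 : ‖F z‖ₑ ≤ ENNReal.ofReal C * eLpNorm F 1 (volume.restrict B) := by
    rw [hrep Ω F z₀ hΩ hF hsub z hz, convolution_def, eLpNorm_one_eq_lintegral_enorm,
      ← lintegral_const_mul' _ _ ENNReal.ofReal_ne_top, ← lintegral_indicator hBm]
    refine (enorm_integral_le_lintegral_enorm _).trans (lintegral_mono fun t => ?_)
    by_cases ht : t ∈ B
    · rw [indicator_of_mem ht, cutRe, indicator_of_mem ht, ContinuousLinearMap.lsmul_apply,
        enorm_smul, mul_comm]
      gcongr
      · rw [← ofReal_norm]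
        exact ENNReal.ofReal_le_ofReal (hC _)
      · rw [← ofReal_norm, ← ofReal_norm]
        exact ENNReal.ofReal_le_ofReal (norm_re_le_norm _)
    · rw [indicator_of_notMem ht, cutRe, indicator_of_notMem ht]
      simp
  refine h2.trans ?_
  rw [mul_assoc, mul_comm (volume B ^ _)]
  gcongr

/-- Convergence in `L²` of metamonogenic functions implies locally uniform convergence. -/
theorem tendstoUniformlyOn_of_tendsto_eLpNorm (hΩ : IsOpen Ω) (hlam : lam ≠ 0)
    {F : ℕ → ℝ × ℝ → ℍ[ℝ]} {G : ℝ × ℝ → ℍ[ℝ]} (hF : ∀ n, F n ∈ M Ω lam) (hG : G ∈ M Ω lam)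
    (h : Tendsto (fun n => eLpNorm (F n - G) 2 (volume.restrict Ω)) atTop (𝓝 0)) :
    ∀ K ⊆ Ω, IsCompact K → TendstoUniformlyOn F G atTop K := by
  rw [← tendstoLocallyUniformlyOn_iff_forall_isCompact hΩ, EMetric.tendstoLocallyUniformlyOn_iff]
  intro e he z hz
  obtain ⟨ε, hε, C, hC, hb⟩ := exists_enorm_le_mul_eLpNorm hΩ hlam hz
  refine ⟨Metric.ball z ε, mem_nhdsWithin_of_mem_nhds (Metric.ball_mem_nhds z hε), ?_⟩
  have h0 := ENNReal.Tendsto.const_mul h (Or.inr hC)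
  rw [mul_zero] at h0
  filter_upwards [h0.eventually_lt_const he] with n hn p hp
  rw [edist_comm, edist_eq_enorm_sub]
  exact (hb _ (sub_mem hΩ (hF n) hG) p hp).trans_lt hn

end Metamonogenic

theorem mainTheorem7 (Ω : Set (ℝ × ℝ)) (hΩ : IsOpen Ω) (lam : ℝ) (hlam : lam ≠ 0) :
    (∀ (F : ℕ → ℝ × ℝ → ℍ[ℝ]) (G : ℝ × ℝ → ℍ[ℝ]),
      (∀ n, F n ∈ Metamonogenic.M Ω lam) →
      (∀ K ⊆ Ω, IsCompact K → TendstoUniformlyOn F G atTop K) →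
      G ∈ Metamonogenic.M Ω lam) ∧
    (∀ (F : ℕ → ℝ × ℝ → ℍ[ℝ]) (G : ℝ × ℝ → ℍ[ℝ]),
      (∀ n, F n ∈ Metamonogenic.M₂ Ω lam) → G ∈ Metamonogenic.M₂ Ω lam →
      Tendsto (fun n => eLpNorm (F n - G) 2 (volume.restrict Ω)) atTop (𝓝 0) →
      ∀ K ⊆ Ω, IsCompact K → TendstoUniformlyOn F G atTop K) :=
  ⟨fun _ _ hF h => Metamonogenic.mem_of_tendstoUniformlyOn hΩ hlam hF h,
    fun _ _ hF hG h => Metamonogenic.tendstoUniformlyOn_of_tendsto_eLpNorm hΩ hlam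
      (fun n => (hF n).1) hG.1 h⟩
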